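/- **Theorem (2nd order convergence of centered moments).** For a set $F\subset\mathbb{R}$ put $\lfloor x\rfloor=\sup\{z\in F: z\le x\}$ and $\lceil x\rceil=\inf\{z\in F: z\ge x\}$. A function $\mathrm{rd}:\mathbb{R}\to F$ is called *round to nearest* (in $F$) if $\mathrm{rd}(x)=\lfloor x\rfloor$ when $x<\frac12(\lfloor x\rfloor+\lceil x\rceil)$, $\mathrm{rd}(x)=\lceil x\rceil$ when $x>\frac12(\lfloor x\rfloor+\lceil x\rceil)$, and $\mathrm{rd}(x)\in\{\lfloor x\rfloor,\lceil x\rceil\}$ in case of a tie. A function $g:\mathbb{R}\to\mathbb{R}$ is said to have *finitely many connected regions of local maxima* if there is a finite set $S\subset\mathbb{R}$ such that $g$ is non-decreasing or non-increasing on every interval disjoint from $S$. Write $\mathbb{M}_k[Y]=\mathbb{E}[(Y-\mathbb{E}[Y])^k]$. Let $k\ge 0$ be an integer and let $X$ be a real random variable with density $f_X\ge 0$ and $\mathbb{E}[X^{2k}]<\infty$. Suppose that for each $n=1,\dots,k$ the function $x\mapsto|x^n f_X(x)|$ is lower semicontinuous, bounded, and has finitely many connected regions of local maxima. Then: 1.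 There are constants $C$ and $\epsilon_0>0$ such that for all $0\le\epsilon\le\epsilon_0$, every $F\subset\mathbb{R}$ and every round to nearest function $\mathrm{rd}:\mathbb{R}\to F$ with $|\mathrm{rd}(x)-x|\le\epsilon|x|$ for all $x\in\mathbb{R}$, the $k$-th absolute moment of $\mathrm{rd}(X)$ is finite and $$\bigl|\mathbb{M}_k[\mathrm{rd}(X)]-\mathbb{M}_k[X]\bigr|\le C\epsilon^2 .$$ 2. If, in addition, $f_X$ itself (the case $n=0$) is lower semicontinuous, bounded, and has finitely many connected regions of local maxima, then there are constants $C$ and $\delta_0>0$ such that for all $0\le\delta\le\delta_0$, every $F\subset\mathbb{R}$ and every round to nearest function $\mathrm{rd}:\mathbb{R}\to F$ with $|\mathrm{rd}(x)-x|\le\delta$ for all $x\in\mathbb{R}$, the $k$-th absolute moment of $\mathrm{rd}(X)$ is finite and $$\bigl|\mathbb{M}_k[\mathrm{rd}(X)]-\mathbb{M}_k[X]\bigr|\le C\delta^2 .$$ The constants depend only on $k$ and the distribution of $X$, not on $F$ or $\mathrm{rd}$. -/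

import Mathlib

open MeasureTheory ProbabilityTheory

namespace Rounding

/-- `⌊x⌋ = sup {z ∈ F : z ≤ x}`, the largest element of the number system `F` below `x`. The real
supremum is the intended one as soon as `F` is unbounded below. -/
noncomputable def floorIn (F : Set ℝ) (x : ℝ) : ℝ := sSup {z | z ∈ F ∧ z ≤ x}

/-- `⌈x⌉ = inf {z ∈ F : x ≤ z}`, the smallest element of the number system `F` above `x`. The real
infimum is the intended one as soon as `F` is unbounded above. -/
noncomputable def ceilIn (F : Set ℝ) (x : ℝ) : ℝ := sInf {z | z ∈ F ∧ x ≤ z}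

/-- `rd : ℝ → F` rounds to nearest. Ties may be broken in any way, and differently at different
points. Because `rd` takes its values in `F`, the set `F` is closed whenever such an `rd` exists and
`F` is unbounded above and below; the latter is forced by `|rd x - x| ≤ ε |x|` with `ε < 1`,
and by `|rd x - x| ≤ δ`. -/
structure IsRoundToNearest (F : Set ℝ) (rd : ℝ → ℝ) : Prop where
  mem : ∀ x, rd x ∈ F
  down : ∀ x, x < (floorIn F x + ceilIn F x) / 2 → rd x = floorIn F x
  up : ∀ x, (floorIn F x + ceilIn F x) / 2 < x → rd x = ceilIn F x
  tie : ∀ x, x = (floorIn F x + ceilIn F x) / 2 → rd x = floorIn F x ∨ rd x = ceilIn F x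

/-- `g` has finitely many connected regions of local maxima: it goes up and down only finitely
often, i.e. there is a finite set `S` of turning points such that `g` is non-decreasing or
non-increasing on every interval that avoids `S`. With one region this is the usual unimodality:
`g` is non-decreasing on `(-∞, x*)` and non-increasing on `(x*, ∞)`. Peaks where a lower
semicontinuous `g` jumps and does not attain its local supremum are counted, and plateaus
on a slope are not. -/
def FinitelyManyMaxRegions (g : ℝ → ℝ) : Prop :=
  ∃ S : Finset ℝ, ∀ I : Set ℝ, I.OrdConnected → Disjoint I (S : Set ℝ) →
    MonotoneOn g I ∨ AntitoneOn g I

/-- The regularity asked of `x ↦ |x ^ n * f x|`. -/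
structure IsNice (g : ℝ → ℝ) : Prop where
  lsc : LowerSemicontinuous g
  bounded : ∃ M : ℝ, ∀ x, |g x| ≤ M
  maxima : FinitelyManyMaxRegions g

end Rounding

namespace Rounding

open Filter Topology Set

/-! The pointwise error `rd x - x` is only first order, but it oscillates: `-(rd x - x)^2 / 2` is a
continuous antiderivative of it, so its integral over any interval, however long, is second order
(`abs_integral_error_le`). Under a relative bound the same holds for `(rd x - x) / x`, up to a
factor growing linearly with the distance from the origin (`abs_integral_relError_le`).

To integrate such a weight against `|x ^ n * f x|`, slice that function by the layer cake formula.
On each of finitely many monotone pieces the superlevel sets are intervals whose distance from the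
origin is controlled by their length, and the lengths integrate over the levels to the integral of
the function. Hence `E[X^j (rd X - X)]` is second order for all `j < k`
(`exists_abs_integral_mul_le`).

Expanding the centered power to first order in `rd X - X` leaves just these correlations and a
quadratic remainder (`exists_centralMoment_add_sub_le`). -/

lemma IsRoundToNearest.abs_sub_le {F : Set ℝ} {rd : ℝ → ℝ} (h : IsRoundToNearest F rd) {x z : ℝ}
    (hlo : ∃ y ∈ F, y ≤ x) (hhi : ∃ y ∈ F, x ≤ y) (hz : z ∈ F) : |rd x - x| ≤ |z - x| := by
  have hlo' : {y | y ∈ F ∧ y ≤ x}.Nonempty := hlo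
  have hhi' : {y | y ∈ F ∧ x ≤ y}.Nonempty := hhi
  have hba : BddAbove {y | y ∈ F ∧ y ≤ x} := ⟨x, fun y hy => hy.2⟩
  have hbb : BddBelow {y | y ∈ F ∧ x ≤ y} := ⟨x, fun y hy => hy.2⟩
  have h1 : floorIn F x ≤ x := csSup_le hlo' fun y hy => hy.2
  have h2 : x ≤ ceilIn F x := le_csInf hhi' fun y hy => hy.2
  have h3 : z ≤ floorIn F x ∨ ceilIn F x ≤ z := by
    rcases le_total z x with hzx | hzx
    · exact Or.inl (le_csSup hba ⟨hz, hzx⟩)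
    · exact Or.inr (csInf_le hbb ⟨hz, hzx⟩)
  have h4 : |rd x - x| ≤ x - floorIn F x ∧ |rd x - x| ≤ ceilIn F x - x := by
    rcases lt_trichotomy x ((floorIn F x + ceilIn F x) / 2) with hx | hx | hx
    · rw [h.down x hx, abs_of_nonpos (by linarith)]
      constructor <;> linarith
    · rcases h.tie x hx with ht | ht
      · rw [ht, abs_of_nonpos (by linarith)]
        constructor <;> linarith
      · rw [ht, abs_of_nonneg (by linarith)]
        constructor <;> linarith
    · rw [h.up x hx, abs_of_nonneg (by linarith)]
      constructor <;> linarith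
  rcases h3 with h3 | h3
  · rw [abs_sub_comm z x]
    exact h4.1.trans (le_trans (by linarith) (le_abs_self _))
  · exact h4.2.trans (le_trans (by linarith) (le_abs_self _))

/-! ### Cancellation of the rounding error over intervals -/

section Nearest

variable {rd : ℝ → ℝ}

lemma sq_sub_le_of_nearest (hN : ∀ x y, |rd x - x| ≤ |rd y - x|) (x y : ℝ) :
    (rd x - x) ^ 2 ≤ (rd y - x) ^ 2 := sq_le_sq.2 (hN x y)

/-- Adding the two squared optimality inequalities gives `(y - x) * (rd y - rd x) ≥ 0`. Monotonicity
supplies measurability and a countable set of discontinuities. -/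
lemma monotone_of_nearest (hN : ∀ x y, |rd x - x| ≤ |rd y - x|) : Monotone rd := by
  intro x y hxy
  rcases hxy.eq_or_lt with rfl | hxy
  · exact le_rfl
  have h1 := sq_sub_le_of_nearest hN x y
  have h2 := sq_sub_le_of_nearest hN y x
  by_contra! hlt
  nlinarith [mul_pos (sub_pos.2 hxy) (sub_pos.2 hlt)]

/-- Half the squared rounding error, which is minus an antiderivative of the rounding error. -/
noncomputable def halfSqError (rd : ℝ → ℝ) (x : ℝ) : ℝ := (rd x - x) ^ 2 / 2

lemma halfSqError_nonneg (rd : ℝ → ℝ) (x : ℝ) : 0 ≤ halfSqError rd x := by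
  unfold halfSqError; positivity

lemma halfSqError_le {x c : ℝ} (h : |rd x - x| ≤ c) : halfSqError rd x ≤ c ^ 2 / 2 := by
  have : (rd x - x) ^ 2 ≤ c ^ 2 := sq_le_sq' (by linarith [neg_abs_le (rd x - x)])
    ((le_abs_self _).trans h)
  unfold halfSqError; linarith

lemma continuous_halfSqError (hN : ∀ x y, |rd x - x| ≤ |rd y - x|) :
    Continuous (halfSqError rd) := by
  -- `|rd x - x|` is the distance from `x` to the range of `rd`, so it is continuous even where `rd`
  -- jumps.
  have h : LipschitzWith 1 fun x => |rd x - x| := by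
    refine LipschitzWith.of_le_add fun x y => ?_
    calc |rd x - x| ≤ |rd y - x| := hN x y
      _ = |(rd y - y) + (y - x)| := by ring_nf
      _ ≤ |rd y - y| + |y - x| := abs_add_le _ _
      _ = _ := by rw [abs_sub_comm y x, Real.dist_eq]
  have h2 : halfSqError rd = fun x => |rd x - x| ^ 2 / 2 := by
    ext x; simp [halfSqError]
  rw [h2]
  exact (h.continuous.pow 2).div_const 2

lemma hasDerivAt_halfSqError (hN : ∀ x y, |rd x - x| ≤ |rd y - x|) {x : ℝ}
    (hx : ContinuousAt rd x) : HasDerivAt (halfSqError rd) (x - rd x) x := by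
  -- This function is convex, being the supremum of `y * z - z ^ 2 / 2` over `z` in the range of
  -- `rd`, and `rd x` is a subgradient at `x`. Optimality at `x` and at `y` puts the linearization
  -- error between `0` and `(rd y - rd x) * (y - x)`.
  have key : HasDerivAt (fun y => y * rd y - rd y ^ 2 / 2) (rd x) x := by
    rw [hasDerivAt_iff_isLittleO]
    have h1 : (fun y => rd y - rd x) =o[𝓝 x] fun _ => (1 : ℝ) := by
      rw [Asymptotics.isLittleO_one_iff]
      simpa using hx.tendsto.sub_const (rd x)
    have h2 := h1.mul_isBigO (Asymptotics.isBigO_refl (fun y : ℝ => y - x) (𝓝 x))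
    simp only [one_mul] at h2
    refine Asymptotics.IsBigO.trans_isLittleO (Asymptotics.IsBigO.of_bound 1 ?_) h2
    refine Eventually.of_forall fun y => ?_
    have h3 := sq_sub_le_of_nearest hN x y
    have h4 := sq_sub_le_of_nearest hN y x
    rw [one_mul, Real.norm_eq_abs, Real.norm_eq_abs, smul_eq_mul]
    refine (abs_le.2 ⟨?_, ?_⟩).trans (le_abs_self _) <;> nlinarith
  have h := ((hasDerivAt_pow 2 x).div_const 2).sub key
  have e : halfSqError rd = (fun y => y ^ 2 / 2) - fun y => y * rd y - rd y ^ 2 / 2 := by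
    ext y; simp only [halfSqError, Pi.sub_apply]; ring
  rw [e]
  exact h.congr_deriv (by norm_num)

lemma intervalIntegrable_error (hN : ∀ x y, |rd x - x| ≤ |rd y - x|) (a b : ℝ) :
    IntervalIntegrable (fun x => rd x - x) volume a b :=
  (monotone_of_nearest hN).intervalIntegrable.sub intervalIntegral.intervalIntegrable_id

lemma integral_error (hN : ∀ x y, |rd x - x| ≤ |rd y - x|) (a b : ℝ) :
    ∫ x in a..b, (rd x - x) = halfSqError rd a - halfSqError rd b := by
  have h := integral_eq_of_hasDerivAt_off_countable
    (- halfSqError rd) (fun x => rd x - x) (a := a) (b := b)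
    (monotone_of_nearest hN).countable_not_continuousAt
    (continuous_halfSqError hN).neg.continuousOn
    (fun x hx => by
      have := (hasDerivAt_halfSqError hN (x := x) (by simpa using hx.2)).neg
      simpa using this)
    (intervalIntegrable_error hN a b)
  rw [h, Pi.neg_apply, Pi.neg_apply]; ring

lemma abs_integral_error_le (hN : ∀ x y, |rd x - x| ≤ |rd y - x|) {δ : ℝ}
    (hδ : ∀ x, |rd x - x| ≤ δ) (a b : ℝ) : |∫ x in a..b, (rd x - x)| ≤ δ ^ 2 := by
  rw [integral_error hN, abs_le]
  have h1 := halfSqError_nonneg rd a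
  have h2 := halfSqError_nonneg rd b
  have h3 := halfSqError_le (hδ a)
  have h4 := halfSqError_le (hδ b)
  constructor <;> nlinarith [sq_nonneg δ]

/-- Integration by parts: `-(D x / x)` has derivative `(rd x - x) / x + D x / x ^ 2`, and `D x ≤ ε ^
2 / 2 * x ^ 2` bounds both the boundary terms and the correction. -/
lemma abs_integral_relError_le (hN : ∀ x y, |rd x - x| ≤ |rd y - x|) {ε : ℝ}
    (hε : ∀ x, |rd x - x| ≤ ε * |x|) {a b R : ℝ} (ha : |a| ≤ R) (hb : |b| ≤ R) :
    |∫ x in a..b, (rd x - x) / x| ≤ 2 * ε ^ 2 * R := by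
  set D := halfSqError rd with hD
  have hDle : ∀ x, D x ≤ ε ^ 2 / 2 * x ^ 2 := fun x => by
    have := halfSqError_le (hε x)
    rw [mul_pow, sq_abs] at this
    linarith
  have hD0 : ∀ x, 0 ≤ D x := halfSqError_nonneg rd
  have hmono := monotone_of_nearest hN
  have hDc : Continuous D := continuous_halfSqError hN
  have hG : ∀ x, |D x / x| ≤ ε ^ 2 / 2 * |x| := fun x => by
    rcases eq_or_ne x 0 with rfl | hx
    · simp
    · rw [abs_div, abs_of_nonneg (hD0 x), div_le_iff₀ (abs_pos.2 hx), mul_assoc, ← sq, sq_abs]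
      exact hDle x
  have hQ : ∀ x, |D x / x ^ 2| ≤ ε ^ 2 / 2 := fun x => by
    rcases eq_or_ne x 0 with rfl | hx
    · simp; positivity
    · rw [abs_div, abs_of_nonneg (hD0 x), abs_of_pos (by positivity),
        div_le_iff₀ (by positivity)]
      exact hDle x
  -- The default value of `D 0 / 0` is `0`, which is also the limit there, so an interval containing
  -- the origin needs no splitting.
  have hGc : Continuous fun x => - (D x / x) := by
    refine Continuous.neg (continuous_iff_continuousAt.2 fun x => ?_)
    rcases eq_or_ne x 0 with rfl | hx
    · rw [ContinuousAt, div_zero]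
      refine squeeze_zero_norm hG ?_
      have : Continuous fun x : ℝ => ε ^ 2 / 2 * |x| := by fun_prop
      simpa using this.tendsto 0
    · exact hDc.continuousAt.div continuousAt_id hx
  have hw : IntervalIntegrable (fun x => (rd x - x) / x) volume a b := by
    refine (intervalIntegrable_const (c := |ε|)).mono_fun'
      ((hmono.measurable.sub measurable_id).div measurable_id).aestronglyMeasurable ?_
    refine Eventually.of_forall fun x => ?_
    simp only [norm_div, Real.norm_eq_abs]
    refine div_le_of_le_mul₀ (abs_nonneg _) (abs_nonneg _) ((hε x).trans ?_)
    exact mul_le_mul_of_nonneg_right (le_abs_self _) (abs_nonneg _)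
  have hq : IntervalIntegrable (fun x => D x / x ^ 2) volume a b :=
    (intervalIntegrable_const (c := ε ^ 2 / 2)).mono_fun'
      (hDc.measurable.div (measurable_id.pow_const 2)).aestronglyMeasurable
      (Eventually.of_forall hQ)
  have hFTC := integral_eq_of_hasDerivAt_off_countable
    (-(D / id)) (fun x => (rd x - x) / x + D x / x ^ 2) (a := a) (b := b)
    (hmono.countable_not_continuousAt.union (countable_singleton 0))
    hGc.continuousOn
    (fun x hx => by
      have hx2 := hx.2
      simp only [mem_union, mem_ofPred_eq, not_or, not_not, mem_singleton_iff] at hx2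
      have h := ((hasDerivAt_halfSqError hN hx2.1).div (hasDerivAt_id x) hx2.2).neg
      refine h.congr_deriv ?_
      have := hx2.2
      simp only [id, hD]
      field_simp
      ring)
    (hw.add hq)
  rw [intervalIntegral.integral_add hw hq] at hFTC
  simp only [Pi.neg_apply, Pi.div_apply, id] at hFTC
  have hI : |∫ x in a..b, D x / x ^ 2| ≤ ε ^ 2 / 2 * |b - a| :=
    intervalIntegral.norm_integral_le_of_norm_le_const (f := fun x => D x / x ^ 2)
      fun x _ => hQ x
  have e1 : ∫ x in a..b, (rd x - x) / x
      = D a / a - D b / b - ∫ x in a..b, D x / x ^ 2 := by linarith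
  have hba : |b - a| ≤ 2 * R := (abs_sub b a).trans (by linarith)
  have hε2 : 0 ≤ ε ^ 2 / 2 := by positivity
  calc |∫ x in a..b, (rd x - x) / x|
      ≤ |D a / a| + |D b / b| + |∫ x in a..b, D x / x ^ 2| := by
        rw [e1]
        exact (abs_sub _ _).trans (add_le_add_left (abs_sub _ _) _)
    _ ≤ ε ^ 2 / 2 * R + ε ^ 2 / 2 * R + ε ^ 2 / 2 * (2 * R) := by
        gcongr
        · exact (hG a).trans (by gcongr)
        · exact (hG b).trans (by gcongr)
        · exact hI.trans (by gcongr)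
    _ = _ := by ring

end Nearest

end Rounding

namespace Rounding

open Set Filter

/-! ### Intervals and superlevel sets of monotone pieces -/

lemma ordConnected_abs_sub_le {I : Set ℝ} (hI : I.OrdConnected) (hfin : volume I ≠ ⊤) {p x : ℝ}
    (hp : p ∈ I) (hx : x ∈ I) : |x - p| ≤ volume.real I := by
  have h : uIcc p x ⊆ I := hI.uIcc_subset hp hx
  have := measureReal_mono h hfin
  rwa [Real.volume_real_interval] at this

lemma exists_setIntegral_eq_intervalIntegral {I : Set ℝ} (hI : I.OrdConnected) {R : ℝ}
    (hR : 0 ≤ R) (hIR : ∀ x ∈ I, |x| ≤ R) :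
    ∃ a b : ℝ, |a| ≤ R ∧ |b| ≤ R ∧ ∀ w : ℝ → ℝ, ∫ x in I, w x = ∫ x in a..b, w x := by
  rcases I.eq_empty_or_nonempty with rfl | hne
  · exact ⟨0, 0, by simpa, by simpa, by simp⟩
  have hsub : I ⊆ Icc (-R) R := fun x hx => abs_le.1 (hIR x hx)
  have hbb : BddBelow I := bddBelow_Icc.mono hsub
  have hba : BddAbove I := bddAbove_Icc.mono hsub
  have hab : sInf I ≤ sSup I := csInf_le_csSup hne hbb hba
  have h1 : Ioo (sInf I) (sSup I) ⊆ I := IsConnected.Ioo_csInf_csSup_subset ⟨hne, hI.isPreconnected⟩ hbb hba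
  have h2 : I ⊆ Icc (sInf I) (sSup I) := subset_Icc_csInf_csSup hbb hba
  obtain ⟨x, hx⟩ := hne
  refine ⟨sInf I, sSup I, abs_le.2 ⟨?_, ?_⟩, abs_le.2 ⟨?_, ?_⟩, fun w => ?_⟩
  · exact le_csInf ⟨x, hx⟩ fun y hy => (hsub hy).1
  · exact (csInf_le hbb hx).trans (hsub hx).2
  · exact (hsub hx).1.trans (le_csSup hba hx)
  · exact csSup_le ⟨x, hx⟩ fun y hy => (hsub hy).2
  · rw [intervalIntegral.integral_of_le hab]
    refine setIntegral_congr_set ?_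
    have h3 : I =ᵐ[volume] Icc (sInf I) (sSup I) :=
      Filter.EventuallyLE.antisymm h2.eventuallyLE
        (Ioo_ae_eq_Icc.symm.le.trans h1.eventuallyLE)
    exact h3.trans Ioc_ae_eq_Icc.symm

/-- The superlevel sets of a function that is monotone on an interval lie in a ball whose radius is
controlled by their length. -/
lemma exists_abs_le_of_superlevel {J : Set ℝ} (hJ : J.OrdConnected) {h : ℝ → ℝ}
    (hmono : MonotoneOn h J ∨ AntitoneOn h J) :
    ∃ T : ℝ, 0 ≤ T ∧ ∀ t : ℝ, (J ∩ {x | t < h x}).OrdConnected ∧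
      (volume (J ∩ {x | t < h x}) ≠ ⊤ →
        ∀ x ∈ J ∩ {x | t < h x}, |x| ≤ T + volume.real (J ∩ {x | t < h x})) := by
  have hoc : ∀ t : ℝ, (J ∩ {x | t < h x}).OrdConnected := fun t => by
    refine ⟨fun x hx y hy z hz => ?_⟩
    have hzJ : z ∈ J := hJ.out hx.1 hy.1 hz
    rcases hmono with hm | hm
    · exact ⟨hzJ, lt_of_lt_of_le hx.2 (hm hx.1 hzJ hz.1)⟩
    · exact ⟨hzJ, lt_of_lt_of_le hy.2 (hm hzJ hy.1 hz.2)⟩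
  rcases J.eq_empty_or_nonempty with hJe | ⟨p, hp⟩
  · exact ⟨0, le_rfl, fun t => ⟨hoc t, fun _ x hx => absurd hx.1 (by simp [hJe])⟩⟩
  -- Levels whose superlevel set contains the reference point `p`. For the others, that set lies on
  -- one side of `p`, and a bound of `J` on that side suffices.
  have hpI : ∀ t : ℝ, volume (J ∩ {x | t < h x}) ≠ ⊤ → ∀ x ∈ J ∩ {x | t < h x},
      t < h p → |x| ≤ |p| + volume.real (J ∩ {x | t < h x}) := fun t hfin x hx ht => by
    have h1 := ordConnected_abs_sub_le (hoc t) hfin ⟨hp, ht⟩ hx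
    have h2 := abs_add_le (x - p) p
    rw [sub_add_cancel] at h2
    linarith
  rcases hmono with hm | hm
  · by_cases hb : BddAbove J
    · obtain ⟨β, hβ⟩ := hb
      refine ⟨|p| + |β|, by positivity, fun t => ⟨hoc t, fun hfin x hx => ?_⟩⟩
      have hv : 0 ≤ volume.real (J ∩ {x | t < h x}) := measureReal_nonneg
      by_cases ht : t < h p
      · have := hpI t hfin x hx ht
        linarith [abs_nonneg β]
      · have hpx : p < x := by
          by_contra! hle
          exact ht (lt_of_lt_of_le hx.2 (hm hx.1 hp hle))
        have h1 : x ≤ β := hβ hx.1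
        rw [abs_le]
        constructor <;> linarith [neg_abs_le p, le_abs_self β, abs_nonneg p, abs_nonneg β]
    · refine ⟨|p|, abs_nonneg p, fun t => ⟨hoc t, fun hfin x hx => ?_⟩⟩
      -- With `J` unbounded on the increasing side, a nonempty superlevel set reaches arbitrarily
      -- far, contradicting its finite length. The decreasing case mirrors this.
      rw [not_bddAbove_iff] at hb
      have hv : 0 ≤ volume.real (J ∩ {x | t < h x}) := measureReal_nonneg
      obtain ⟨y, hyJ, hy⟩ := hb (x + volume.real (J ∩ {x | t < h x}))
      have hyI : y ∈ J ∩ {x | t < h x} :=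
        ⟨hyJ, lt_of_lt_of_le hx.2 (hm hx.1 hyJ (by linarith))⟩
      have := (le_abs_self _).trans (ordConnected_abs_sub_le (hoc t) hfin hx hyI)
      linarith
  · by_cases hb : BddBelow J
    · obtain ⟨β, hβ⟩ := hb
      refine ⟨|p| + |β|, by positivity, fun t => ⟨hoc t, fun hfin x hx => ?_⟩⟩
      have hv : 0 ≤ volume.real (J ∩ {x | t < h x}) := measureReal_nonneg
      by_cases ht : t < h p
      · have := hpI t hfin x hx ht
        linarith [abs_nonneg β]
      · have hpx : x < p := by
          by_contra! hle
          exact ht (lt_of_lt_of_le hx.2 (hm hp hx.1 hle))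
        have h1 : β ≤ x := hβ hx.1
        rw [abs_le]
        constructor <;> linarith [neg_abs_le β, le_abs_self p, abs_nonneg p, abs_nonneg β]
    · refine ⟨|p|, abs_nonneg p, fun t => ⟨hoc t, fun hfin x hx => ?_⟩⟩
      rw [not_bddBelow_iff] at hb
      have hv : 0 ≤ volume.real (J ∩ {x | t < h x}) := measureReal_nonneg
      obtain ⟨y, hyJ, hy⟩ := hb (x - volume.real (J ∩ {x | t < h x}))
      have hyI : y ∈ J ∩ {x | t < h x} :=
        ⟨hyJ, lt_of_lt_of_le hx.2 (hm hyJ hx.1 (by linarith))⟩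
      have := (le_abs_self _).trans (ordConnected_abs_sub_le (hoc t) hfin hyI hx)
      linarith

/-! ### Integrating an oscillating weight against a piecewise monotone function -/

/-- The layer cake formula for a bounded nonnegative function against a bounded signed weight. -/
lemma layercake_bounded_weight {μ : Measure ℝ} [SFinite μ] {h w : ℝ → ℝ} {M D : ℝ}
    (hh : Measurable h) (h0 : ∀ x, 0 ≤ h x) (hM : ∀ x, h x ≤ M) (hint : Integrable h μ)
    (hw : Measurable w) (hD : ∀ x, |w x| ≤ D) :
    IntegrableOn (fun t => ∫ x in {x | t < h x}, w x ∂μ) (Ioc 0 M) ∧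
    ∫ t in Ioc 0 M, ∫ x in {x | t < h x}, w x ∂μ = ∫ x, h x * w x ∂μ := by
  have hlt : MeasurableSet {p : ℝ × ℝ | p.2 < h p.1} :=
    measurableSet_lt measurable_snd (hh.comp measurable_fst)
  set G : ℝ × ℝ → ℝ := {p : ℝ × ℝ | p.2 < h p.1}.indicator fun p => w p.1 with hG
  have hGm : Measurable G := (hw.comp measurable_fst).indicator hlt
  have hslice : ∀ x, (fun t => G (x, t)) = (Iio (h x)).indicator fun _ => w x := fun x => by
    ext t; simp [hG, indicator_apply]
  have hinter : ∀ x, (Iio (h x) ∩ Ioc 0 M : Set ℝ) =ᵐ[volume] (Ioc 0 (h x) : Set ℝ) := fun x => by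
    have : Iio (h x) ∩ Ioc 0 M = Ioo 0 (h x) := by
      ext t; simp only [mem_inter_iff, mem_Iio, mem_Ioc, mem_Ioo]
      constructor
      · rintro ⟨h1, h2, h3⟩; exact ⟨h2, h1⟩
      · rintro ⟨h1, h2⟩; exact ⟨h2, h1, h2.le.trans (hM x)⟩
    rw [this]; exact Ioo_ae_eq_Ioc
  have hin : ∀ x (c : ℝ), ∫ t in Ioc 0 M, (Iio (h x)).indicator (fun _ => c) t = h x * c :=
    fun x c => by
      rw [integral_indicator measurableSet_Iio, Measure.restrict_restrict measurableSet_Iio,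
        setIntegral_congr_set (hinter x), setIntegral_const, Real.volume_real_Ioc_of_le (h0 x),
        sub_zero, smul_eq_mul]
  have hGint : Integrable G (μ.prod (volume.restrict (Ioc 0 M))) := by
    rw [integrable_prod_iff hGm.aestronglyMeasurable]
    refine ⟨Eventually.of_forall fun x => ?_, ?_⟩
    · rw [hslice]
      exact (integrable_const _).indicator measurableSet_Iio
    · have : (fun x => ∫ t in Ioc 0 M, ‖G (x, t)‖) = fun x => h x * ‖w x‖ := by
        ext x
        rw [← hin x]
        refine integral_congr_ae (Eventually.of_forall fun t => ?_)
        have := congrFun (hslice x) t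
        simp only [this, norm_indicator_eq_indicator_norm]
      rw [this]
      exact hint.mul_bdd hw.norm.aestronglyMeasurable
        (Eventually.of_forall fun x => by rw [norm_norm]; exact hD x)
  have hswap : ∀ t, ∫ x, G (x, t) ∂μ = ∫ x in {x | t < h x}, w x ∂μ := fun t => by
    rw [← integral_indicator (measurableSet_lt measurable_const hh)]
    refine integral_congr_ae (Eventually.of_forall fun x => ?_)
    simp [hG, indicator_apply]
  refine ⟨?_, ?_⟩
  · have := hGint.integral_prod_right
    simp only [hswap] at this
    exact this
  · have := integral_integral_swap (f := fun x t => G (x, t)) hGint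
    simp only [hswap] at this
    rw [← this]
    refine integral_congr_ae (Eventually.of_forall fun x => ?_)
    simp only [hslice, hin]

/-- Each level contributes at most `K * (1 + T + length)`; integrating over levels in `(0, M]` gives
the constant. It is chosen before `w`, and the sup bound `D` serves integrability only, so the
smallness of `K` survives. -/
lemma exists_abs_setIntegral_mul_le {J : Set ℝ} (hJ : J.OrdConnected) {h : ℝ → ℝ} {M : ℝ}
    (hh : Measurable h) (h0 : ∀ x, 0 ≤ h x) (hM : ∀ x, h x ≤ M) (hint : Integrable h)
    (hmono : MonotoneOn h J ∨ AntitoneOn h J) :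
    ∃ C : ℝ, 0 ≤ C ∧ ∀ (w : ℝ → ℝ) (K D : ℝ), Measurable w → (∀ x, |w x| ≤ D) →
      (∀ a b R : ℝ, |a| ≤ R → |b| ≤ R → |∫ x in a..b, w x| ≤ K * (1 + R)) →
      |∫ x in J, h x * w x| ≤ C * K := by
  obtain ⟨T, hT, hTb⟩ := exists_abs_le_of_superlevel hJ hmono
  have hM0 : 0 ≤ M := (h0 0).trans (hM 0)
  have hJm : MeasurableSet J := hJ.measurableSet
  refine ⟨(1 + T) * M + ∫ x in J, h x, ?_, fun w K D hw hD hK => ?_⟩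
  · have : 0 ≤ ∫ x in J, h x := integral_nonneg h0
    positivity
  have hlev : ∀ t, MeasurableSet {x | t < h x} := fun t => measurableSet_lt measurable_const hh
  have hrest : ∀ t, (volume.restrict J).restrict {x | t < h x}
      = volume.restrict (J ∩ {x | t < h x}) := fun t => by
    rw [Measure.restrict_restrict (hlev t), inter_comm]
  obtain ⟨_, hw2⟩ := layercake_bounded_weight (μ := volume.restrict J) hh h0 hM hint.restrict hw hD
  -- Weight `1` turns the integral of the lengths of the superlevel sets into the integral of `h`
  -- over `J`.
  obtain ⟨hv1, hv2⟩ := layercake_bounded_weight (μ := volume.restrict J) (w := fun _ => 1) hh h0 hM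
    hint.restrict measurable_const (fun _ => (abs_one).le)
  simp only [hrest, setIntegral_const, smul_eq_mul, mul_one] at hw2 hv1 hv2
  rw [← hw2]
  have hB : IntegrableOn (fun t => K * (1 + T) + K * volume.real (J ∩ {x | t < h x}))
      (Ioc 0 M) := (integrable_const _).add (hv1.const_mul K)
  have hle := norm_integral_le_of_norm_le (f := fun t => ∫ x in J ∩ {x | t < h x}, w x) hB ?_
  · refine hle.trans (le_of_eq ?_)
    rw [integral_add (integrable_const _) (hv1.const_mul K), integral_const_mul K fun t =>
      volume.real (J ∩ {x | t < h x}), hv2, setIntegral_const, Real.volume_real_Ioc_of_le hM0, smul_eq_mul]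
    ring
  · refine (ae_restrict_iff' measurableSet_Ioc).2 (Eventually.of_forall fun t ht => ?_)
    have hfin : volume (J ∩ {x | t < h x}) ≠ ⊤ :=
      ((measure_mono inter_subset_right).trans_lt (hint.measure_gt_lt_top ht.1)).ne
    have hv : 0 ≤ volume.real (J ∩ {x | t < h x}) := measureReal_nonneg
    obtain ⟨a, b, ha, hb, hab⟩ := exists_setIntegral_eq_intervalIntegral (hTb t).1
      (add_nonneg hT hv) ((hTb t).2 hfin)
    rw [hab, Real.norm_eq_abs]
    refine (hK a b _ ha hb).trans (le_of_eq ?_)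
    ring

/-- The points outside the finite set `S` that lie above exactly the elements of `U`. -/
def finsetCell (S U : Finset ℝ) : Set ℝ := {x | x ∉ S ∧ S.filter (· < x) = U}

lemma ordConnected_finsetCell (S U : Finset ℝ) : (finsetCell S U).OrdConnected := by
  refine ⟨fun x hx y hy z hz => ?_⟩
  have h : S.filter (· < z) = U := by
    refine Finset.Subset.antisymm ?_ ?_
    · rw [← hy.2]
      exact Finset.monotone_filter_right S fun s _ hs => lt_of_lt_of_le hs hz.2
    · rw [← hx.2]
      exact Finset.monotone_filter_right S fun s _ hs => lt_of_lt_of_le hs hz.1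
  refine ⟨fun hzS => ?_, h⟩
  have hzy : z < y := lt_of_le_of_ne hz.2 fun e => hy.1 (e ▸ hzS)
  have : z ∈ S.filter (· < z) := by rw [h, ← hy.2]; simp [hzS, hzy]
  simp at this

lemma abs_integral_le_sum_finsetCell (S : Finset ℝ) {g : ℝ → ℝ} (hg : Integrable g) :
    |∫ x, g x| ≤ ∑ U ∈ S.powerset, |∫ x in finsetCell S U, g x| := by
  have hunion : (⋃ U ∈ S.powerset, finsetCell S U) =ᵐ[volume] univ := by
    rw [eventuallyEq_univ, mem_ae_iff]
    refine measure_mono_null (t := (S : Set ℝ)) (fun x hx => ?_) (S.finite_toSet.measure_zero volume)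
    by_contra hxS
    refine hx (mem_iUnion₂.2 ⟨S.filter (· < x), ?_, hxS, rfl⟩)
    exact Finset.mem_powerset.2 (Finset.filter_subset _ _)
  have h := integral_biUnion_finset (μ := volume) (f := g) S.powerset
    (s := finsetCell S)
    (fun U _ => (ordConnected_finsetCell S U).measurableSet)
    (fun U _ V _ hUV => disjoint_left.2 fun x hx hy => hUV (hx.2.symm.trans hy.2))
    (fun U _ => hg.integrableOn)
  rw [setIntegral_congr_set hunion, setIntegral_univ] at h
  rw [h]
  exact Finset.abs_sum_le_sum_abs _ _

lemma exists_abs_integral_mul_le {f : ℝ → ℝ} (hf : Measurable f) (hf0 : ∀ x, 0 ≤ f x) (n : ℕ)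
    (hint : Integrable fun x => x ^ n * f x) (hnice : IsNice fun x => |x ^ n * f x|) :
    ∃ C : ℝ, 0 ≤ C ∧ ∀ (w : ℝ → ℝ) (K D : ℝ), Measurable w → (∀ x, |w x| ≤ D) →
      (∀ a b R : ℝ, |a| ≤ R → |b| ≤ R → |∫ x in a..b, w x| ≤ K * (1 + R)) →
      |∫ x, x ^ n * f x * w x| ≤ C * K := by
  obtain ⟨M, hM⟩ := hnice.bounded
  obtain ⟨S₀, hS₀⟩ := hnice.maxima
  -- Adding `0` as a breakpoint fixes the sign of `x ^ n` on each cell, so `x ^ n * f x` is `|x ^ n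
  -- * f x|` up to a constant sign there.
  set S := insert 0 S₀ with hS
  have hpiece : ∀ U : Finset ℝ, ∃ C : ℝ, 0 ≤ C ∧ ∀ (w : ℝ → ℝ) (K D : ℝ), Measurable w →
      (∀ x, |w x| ≤ D) →
      (∀ a b R : ℝ, |a| ≤ R → |b| ≤ R → |∫ x in a..b, w x| ≤ K * (1 + R)) →
      |∫ x in finsetCell S U, |x ^ n * f x| * w x| ≤ C * K := fun U => by
    have hJ := ordConnected_finsetCell S U
    refine exists_abs_setIntegral_mul_le hJ (((measurable_id.pow_const n).mul hf).abs)
      (fun x => abs_nonneg _) (fun x => (le_abs_self _).trans (hM x)) hint.abs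
      (hS₀ _ hJ (disjoint_left.2 fun x hx hxS => hx.1 ?_))
    exact Finset.mem_insert_of_mem hxS
  choose C hC0 hC using hpiece
  refine ⟨∑ U ∈ S.powerset, C U, Finset.sum_nonneg fun U _ => hC0 U, fun w K D hw hD hK => ?_⟩
  have hgi : Integrable fun x => x ^ n * f x * w x :=
    hint.mul_bdd hw.aestronglyMeasurable (Eventually.of_forall hD)
  refine (abs_integral_le_sum_finsetCell S hgi).trans ?_
  rw [Finset.sum_mul]
  refine Finset.sum_le_sum fun U _ => ?_
  refine le_trans (le_of_eq ?_) (hC U w K D hw hD hK)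
  have hJm := (ordConnected_finsetCell S U).measurableSet
  have h0S : (0 : ℝ) ∈ S := Finset.mem_insert_self _ _
  by_cases h0 : (0 : ℝ) ∈ U
  · congr 1
    refine setIntegral_congr_fun hJm fun x hx => ?_
    have hx0 : 0 < x := by
      rw [← hx.2] at h0
      exact (Finset.mem_filter.1 h0).2
    rw [abs_of_nonneg (mul_nonneg (pow_nonneg hx0.le n) (hf0 x))]
  · have e : ∀ x ∈ finsetCell S U, x ^ n * f x * w x = (-1) ^ n * (|x ^ n * f x| * w x) :=
      fun x hx => by
        have hx0 : x ≤ 0 := by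
          by_contra! hlt
          exact h0 (hx.2 ▸ Finset.mem_filter.2 ⟨h0S, hlt⟩)
        rw [abs_mul, abs_pow, abs_of_nonpos hx0, abs_of_nonneg (hf0 x), ← mul_assoc, ← mul_assoc,
          ← mul_pow]
        simp
    rw [setIntegral_congr_fun hJm e, integral_const_mul, abs_mul, abs_pow]
    simp

/-! ### Perturbation of central moments -/

lemma exists_abs_add_pow_sub_le (k : ℕ) : ∃ c : ℝ, 0 ≤ c ∧ ∀ a b L η : ℝ, 0 ≤ η → η ≤ 1 →
    |a| ≤ L → |b| ≤ η * L →
    |(a + b) ^ k - a ^ k - k * a ^ (k - 1) * b| ≤ c * η ^ 2 * L ^ k := by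
  induction k with
  | zero => exact ⟨0, le_rfl, fun a b L η _ _ _ _ => by simp⟩
  | succ k ih =>
    obtain ⟨c, hc, ih⟩ := ih
    refine ⟨2 * c + k, by positivity, fun a b L η h0 h1 ha hb => ?_⟩
    have hL : 0 ≤ L := (abs_nonneg a).trans ha
    -- Recursion for the Taylor remainder. The truncated exponent `k - 1` at `k = 0` is harmless,
    -- since its coefficient vanishes.
    have e1 : (a + b) ^ (k + 1) - a ^ (k + 1) - ((k + 1 : ℕ) : ℝ) * a ^ (k + 1 - 1) * b
        = (a + b) * ((a + b) ^ k - a ^ k - k * a ^ (k - 1) * b) + k * a ^ (k - 1) * b ^ 2 := by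
      rcases k with _ | m
      · simp
      · simp only [Nat.add_sub_cancel]; push_cast; ring
    have e2 : (k : ℝ) * L ^ (k - 1) * (η * L) ^ 2 = k * η ^ 2 * L ^ (k + 1) := by
      rcases k with _ | m
      · simp
      · simp only [Nat.add_sub_cancel]; ring
    have hb2 : |b| ≤ L := hb.trans (by nlinarith)
    rw [e1]
    calc _ ≤ |a + b| * |(a + b) ^ k - a ^ k - k * a ^ (k - 1) * b|
          + k * |a| ^ (k - 1) * |b| ^ 2 := by
          refine (abs_add_le _ _).trans (le_of_eq ?_)
          rw [abs_mul, abs_mul, abs_mul, abs_pow, abs_pow, Nat.abs_cast]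
      _ ≤ (2 * L) * (c * η ^ 2 * L ^ k) + k * L ^ (k - 1) * (η * L) ^ 2 := by
          gcongr
          · exact (abs_add_le a b).trans (by linarith)
          · exact ih a b L η h0 h1 ha hb
      _ = _ := by rw [e2]; ring

/-- The first-order term is `k * E[(X - m)^(k-1) (Z - ν)]` with `m = E[X]`, `ν = E[Z]`. Its `Z` part
expands binomially into the assumed correlations, and `ν` is the correlation with `j = 0`. The bound
`η * (1 + |X|)` accommodates both absolute and relative rounding errors. -/
lemma exists_centralMoment_add_sub_le {Ω : Type*} [MeasurableSpace Ω] (P : Measure Ω)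
    [IsProbabilityMeasure P] {X : Ω → ℝ} {k : ℕ} (hX : MemLp X k P) (C₀ : ℝ) :
    ∃ C : ℝ, ∀ (Z : Ω → ℝ) (η : ℝ), 0 ≤ η → η ≤ 1 → AEStronglyMeasurable Z P →
      (∀ ω, |Z ω| ≤ η * (1 + |X ω|)) →
      (∀ j < k, |∫ ω, X ω ^ j * Z ω ∂P| ≤ C₀ * η ^ 2) →
      MemLp (fun ω => X ω + Z ω) k P ∧
      |centralMoment (fun ω => X ω + Z ω) k P - centralMoment X k P| ≤ C * η ^ 2 := by
  have hXm : AEStronglyMeasurable X P := hX.1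
  rcases Nat.eq_zero_or_pos k with rfl | hk
  · refine ⟨0, fun Z η _ _ hZm _ _ => ⟨?_, ?_⟩⟩
    · rw [Nat.cast_zero, memLp_zero_iff_aestronglyMeasurable]
      exact hXm.add hZm
    · simp [centralMoment]
  have hk1 : (1 : ENNReal) ≤ k := by exact_mod_cast hk
  have hXint : Integrable X P := hX.integrable hk1
  set A := ∫ ω, |X ω| ∂P with hA
  set m := ∫ ω, X ω ∂P with hm
  have hA0 : 0 ≤ A := integral_nonneg fun ω => abs_nonneg _
  have hmA : |m| ≤ A := abs_integral_le_integral_abs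
  -- Chosen so that `|X - m| ≤ L` and `|Z - ν| ≤ η * (1 + |X|) + η * (1 + A) = η * L`. Since `L ≥
  -- 1`, lower powers are dominated by `L ^ k`.
  set L : Ω → ℝ := fun ω => 2 + |X ω| + A with hL
  have hL1 : ∀ ω, 1 ≤ L ω := fun ω => by
    have := abs_nonneg (X ω)
    simp only [hL]; linarith
  have hLp : MemLp L k P := by
    have h2 : MemLp (fun _ : Ω => (2 : ℝ)) k P := memLp_const 2
    have hA' : MemLp (fun _ : Ω => A) k P := memLp_const A
    exact (h2.add hX.abs).add hA'
  have hLk : Integrable (fun ω => L ω ^ k) P := by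
    refine (hLp.integrable_norm_pow hk.ne').congr (Filter.Eventually.of_forall fun ω => ?_)
    simp only [Real.norm_eq_abs, abs_of_nonneg (zero_le_one.trans (hL1 ω))]
  have hdom : ∀ g : Ω → ℝ, AEStronglyMeasurable g P → ∀ c : ℝ, (∀ ω, |g ω| ≤ c * L ω ^ k) →
      Integrable g P := fun g hg c h =>
    (hLk.const_mul c).mono' hg (Filter.Eventually.of_forall h)
  obtain ⟨c, hc, hrem⟩ := exists_abs_add_pow_sub_le k
  set B := ∫ ω, (X ω - m) ^ (k - 1) ∂P with hB
  set Q : ℝ := ∑ j ∈ Finset.range k, |(-m) ^ (k - 1 - j) * (k - 1).choose j| with hQ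
  refine ⟨k * (Q * C₀ + C₀ * |B|) + c * ∫ ω, L ω ^ k ∂P, fun Z η h0 h1 hZm hZ hj => ?_⟩
  have hXL : ∀ ω, |X ω| ≤ L ω := fun ω => by simp only [hL]; linarith
  have hZL' : ∀ ω, |Z ω| ≤ η * L ω := fun ω =>
    (hZ ω).trans (mul_le_mul_of_nonneg_left (by simp only [hL]; linarith) h0)
  have hZL : ∀ ω, |Z ω| ≤ L ω := fun ω => (hZL' ω).trans (by nlinarith [hL1 ω])
  have hZp : MemLp Z k P := hLp.mono hZm (Filter.Eventually.of_forall fun ω => by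
    rw [Real.norm_eq_abs, Real.norm_eq_abs]
    exact (hZL ω).trans (le_abs_self _))
  have hZint : Integrable Z P := hZp.integrable hk1
  refine ⟨hX.add hZp, ?_⟩
  set ν := ∫ ω, Z ω ∂P with hν
  have hνC : |ν| ≤ C₀ * η ^ 2 := by simpa using hj 0 hk
  have hνη : |ν| ≤ η * (1 + A) := by
    calc |ν| ≤ ∫ ω, |Z ω| ∂P := abs_integral_le_integral_abs
      _ ≤ ∫ ω, η * (1 + |X ω|) ∂P :=
        integral_mono hZint.abs (((integrable_const 1).add hXint.abs).const_mul η) hZ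
      _ = η * (1 + A) := by
        rw [integral_const_mul, integral_add (integrable_const 1) hXint.abs]; simp [hA]
  set a : Ω → ℝ := fun ω => X ω - m with ha
  set b : Ω → ℝ := fun ω => Z ω - ν with hb
  have haL : ∀ ω, |a ω| ≤ L ω := fun ω => by
    refine (abs_sub _ _).trans ?_
    simp only [hL]; linarith
  have hbL : ∀ ω, |b ω| ≤ η * L ω := fun ω => by
    refine (abs_sub _ _).trans ((add_le_add (hZ ω) hνη).trans (le_of_eq ?_))
    simp only [hL]; ring
  have hbL1 : ∀ ω, |b ω| ≤ L ω := fun ω => (hbL ω).trans (by nlinarith [hL1 ω])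
  have ham : AEStronglyMeasurable a P := hXm.sub aestronglyMeasurable_const
  have hbm : AEStronglyMeasurable b P := hZm.sub aestronglyMeasurable_const
  have iak : Integrable (fun ω => a ω ^ k) P := hdom _ (ham.pow k) 1 fun ω => by
    rw [abs_pow, one_mul]; exact pow_le_pow_left₀ (abs_nonneg _) (haL ω) k
  have iabk : Integrable (fun ω => (a ω + b ω) ^ k) P :=
    hdom _ ((ham.add hbm).pow k) (2 ^ k) fun ω => by
      rw [abs_pow, ← mul_pow]
      refine pow_le_pow_left₀ (abs_nonneg _) ((abs_add_le _ _).trans ?_) k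
      linarith [haL ω, hbL1 ω]
  have iaj : Integrable (fun ω => a ω ^ (k - 1)) P := hdom _ (ham.pow _) 1 fun ω => by
    rw [abs_pow, one_mul]
    exact (pow_le_pow_left₀ (abs_nonneg _) (haL ω) _).trans
      (pow_le_pow_right₀ (hL1 ω) (Nat.sub_le _ _))
  have iXZ : ∀ j < k, Integrable (fun ω => X ω ^ j * Z ω) P := fun j hjk =>
    hdom _ ((hXm.pow j).mul hZm) 1 fun ω => by
      rw [abs_mul, abs_pow, one_mul]
      calc |X ω| ^ j * |Z ω| ≤ L ω ^ j * L ω := by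
            gcongr
            · exact hXL ω
            · exact hZL ω
        _ = L ω ^ (j + 1) := (pow_succ _ _).symm
        _ ≤ L ω ^ k := pow_le_pow_right₀ (hL1 ω) hjk
  have hexp : ∀ ω, a ω ^ (k - 1) * Z ω = ∑ j ∈ Finset.range k,
      ((-m) ^ (k - 1 - j) * (k - 1).choose j) * (X ω ^ j * Z ω) := fun ω => by
    simp only [ha]
    rw [sub_eq_add_neg, add_pow, Nat.sub_add_cancel hk, Finset.sum_mul]
    exact Finset.sum_congr rfl fun j _ => by ring
  have iaZ : Integrable (fun ω => a ω ^ (k - 1) * Z ω) P := by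
    simp only [hexp]
    exact integrable_finsetSum _ fun j hjr => (iXZ j (Finset.mem_range.1 hjr)).const_mul _
  have haZ : |∫ ω, a ω ^ (k - 1) * Z ω ∂P| ≤ Q * (C₀ * η ^ 2) := by
    simp only [hexp]
    rw [integral_finsetSum _ fun j hjr => (iXZ j (Finset.mem_range.1 hjr)).const_mul _, hQ,
      Finset.sum_mul]
    refine (Finset.abs_sum_le_sum_abs _ _).trans (Finset.sum_le_sum fun j hjr => ?_)
    rw [integral_const_mul, abs_mul]
    exact mul_le_mul_of_nonneg_left (hj j (Finset.mem_range.1 hjr)) (abs_nonneg _)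
  have iab : Integrable (fun ω => a ω ^ (k - 1) * b ω) P := by
    refine (iaZ.sub (iaj.mul_const ν)).congr (Filter.Eventually.of_forall fun ω => ?_)
    simp only [hb, Pi.sub_apply]; ring
  have hab : |∫ ω, a ω ^ (k - 1) * b ω ∂P| ≤ Q * (C₀ * η ^ 2) + C₀ * η ^ 2 * |B| := by
    have e : ∫ ω, a ω ^ (k - 1) * b ω ∂P = ∫ ω, a ω ^ (k - 1) * Z ω ∂P - B * ν := by
      rw [hB, ← integral_mul_const, ← integral_sub iaZ (iaj.mul_const ν)]
      refine integral_congr_ae (Filter.Eventually.of_forall fun ω => ?_)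
      simp only [hb]; ring
    rw [e]
    refine (abs_sub _ _).trans (add_le_add haZ ?_)
    rw [abs_mul, mul_comm]
    exact mul_le_mul_of_nonneg_right hνC (abs_nonneg _)
  have hR : |∫ ω, ((a ω + b ω) ^ k - a ω ^ k - k * (a ω ^ (k - 1) * b ω)) ∂P|
      ≤ c * η ^ 2 * ∫ ω, L ω ^ k ∂P := by
    rw [← integral_const_mul]
    rw [← Real.norm_eq_abs]
    refine norm_integral_le_of_norm_le (hLk.const_mul _) (Filter.Eventually.of_forall fun ω => ?_)
    rw [← mul_assoc]
    exact hrem _ _ _ η h0 h1 (haL ω) (hbL ω)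
  have hlin : ∫ ω, ((a ω + b ω) ^ k - a ω ^ k - k * (a ω ^ (k - 1) * b ω)) ∂P
      = ∫ ω, (a ω + b ω) ^ k ∂P - ∫ ω, a ω ^ k ∂P - k * ∫ ω, a ω ^ (k - 1) * b ω ∂P := by
    rw [← integral_const_mul, ← integral_sub iabk iak]
    exact integral_sub (iabk.sub iak) (iab.const_mul _)
  rw [hlin] at hR
  have hcX : centralMoment X k P = ∫ ω, a ω ^ k ∂P := rfl
  have hcY : centralMoment (fun ω => X ω + Z ω) k P = ∫ ω, (a ω + b ω) ^ k ∂P := by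
    simp only [centralMoment, Pi.pow_apply, Pi.sub_apply]
    rw [integral_add hXint hZint]
    refine integral_congr_ae (Filter.Eventually.of_forall fun ω => ?_)
    simp only [ha, hb]; ring
  rw [hcX, hcY]
  have hfin : |(k : ℝ) * ∫ ω, a ω ^ (k - 1) * b ω ∂P|
      ≤ k * (Q * (C₀ * η ^ 2) + C₀ * η ^ 2 * |B|) := by
    rw [abs_mul, Nat.abs_cast]
    exact mul_le_mul_of_nonneg_left hab (Nat.cast_nonneg k)
  have := abs_le.1 hR
  have := abs_le.1 hfin
  rw [abs_le]
  constructor <;> linarith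

/-! ### Passage to the density and the two error models -/

lemma integrable_comp_and_integral_comp {Ω : Type*} [MeasurableSpace Ω] {P : Measure Ω}
    {X : Ω → ℝ} (hX : AEMeasurable X P) {f : ℝ → ℝ} (hf : Measurable f) (hf0 : ∀ x, 0 ≤ f x)
    (hd : P.map X = volume.withDensity fun x => ENNReal.ofReal (f x)) {g : ℝ → ℝ}
    (hg : Measurable g) :
    (Integrable (fun ω => g (X ω)) P ↔ Integrable fun x => f x * g x) ∧
    ∫ ω, g (X ω) ∂P = ∫ x, f x * g x := by
  have hfm : Measurable fun x => ENNReal.ofReal (f x) := hf.ennreal_ofReal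
  have hfin : ∀ᵐ x ∂(volume : Measure ℝ), ENNReal.ofReal (f x) < ⊤ :=
    Filter.Eventually.of_forall fun x => ENNReal.ofReal_lt_top
  constructor
  · have h1 := integrable_map_measure (μ := P) (f := X) (g := g) hg.aestronglyMeasurable hX
    have h2 := integrable_withDensity_iff_integrable_smul' (μ := volume) (g := g) hfm hfin
    rw [hd] at h1
    simp only [ENNReal.toReal_ofReal (hf0 _), smul_eq_mul] at h2
    exact h1.symm.trans h2
  · rw [← integral_map hX hg.aestronglyMeasurable, hd,
      integral_withDensity_eq_integral_toReal_smul hfm hfin]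
    simp only [ENNReal.toReal_ofReal (hf0 _), smul_eq_mul]

/-- The points `±(2|x| + 2)` move by at most `|x| + 2`, so their roundings are elements of `F` on
either side of `x`. The error bound is weak enough to cover `ε ≤ 1/2` and `δ ≤ 1` alike. -/
lemma nearest_of_abs_sub_le {F : Set ℝ} {rd : ℝ → ℝ} (h : IsRoundToNearest F rd)
    (hrd : ∀ x, |rd x - x| ≤ 1 + |x| / 2) (x z : ℝ) : |rd x - x| ≤ |rd z - x| := by
  have ha := abs_nonneg x
  refine h.abs_sub_le ⟨rd (-(2 * |x| + 2)), h.mem _, ?_⟩ ⟨rd (2 * |x| + 2), h.mem _, ?_⟩ (h.mem z)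
  · have h1 := hrd (-(2 * |x| + 2))
    rw [abs_neg, abs_of_nonneg (by positivity : (0 : ℝ) ≤ 2 * |x| + 2)] at h1
    linarith [(abs_le.1 h1).2, neg_abs_le x]
  · have h1 := hrd (2 * |x| + 2)
    rw [abs_of_nonneg (by positivity : (0 : ℝ) ≤ 2 * |x| + 2)] at h1
    linarith [(abs_le.1 h1).1, le_abs_self x]

lemma memLp_of_integrable_pow_two_mul {Ω : Type*} [MeasurableSpace Ω] {P : Measure Ω}
    [IsProbabilityMeasure P] {X : Ω → ℝ} (hX : AEMeasurable X P) {k : ℕ}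
    (h : Integrable (fun ω => X ω ^ (2 * k)) P) : MemLp X k P := by
  rcases Nat.eq_zero_or_pos k with rfl | hk
  · rw [Nat.cast_zero, memLp_zero_iff_aestronglyMeasurable]
    exact hX.aestronglyMeasurable
  · rw [← integrable_norm_rpow_iff hX.aestronglyMeasurable (by exact_mod_cast hk.ne')
      (ENNReal.natCast_ne_top k)]
    simp only [ENNReal.toReal_natCast, Real.rpow_natCast]
    refine (h.add (integrable_const 1)).mono' (hX.aestronglyMeasurable.norm.pow k)
      (Filter.Eventually.of_forall fun ω => ?_)
    simp only [Real.norm_eq_abs, abs_pow, abs_abs, Pi.add_apply]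
    have e : X ω ^ (2 * k) = (|X ω| ^ k) ^ 2 := by
      rw [← pow_mul, mul_comm k 2, pow_mul, pow_mul, sq_abs]
    rw [e]
    nlinarith [sq_nonneg (|X ω| ^ k - 1)]

end Rounding

open Rounding in
theorem mainTheorem2 {Ω : Type*} [MeasurableSpace Ω] (P : Measure Ω) [IsProbabilityMeasure P]
    (X : Ω → ℝ) (hX : AEMeasurable X P)
    (f : ℝ → ℝ) (hf_meas : Measurable f) (hf_nonneg : ∀ x, 0 ≤ f x)
    (hf_density : P.map X = volume.withDensity (fun x => ENNReal.ofReal (f x)))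
    (k : ℕ) (h_moment : Integrable (fun ω => X ω ^ (2 * k)) P)
    (h_nice : ∀ n : ℕ, 1 ≤ n → n ≤ k → Rounding.IsNice (fun x => |x ^ n * f x|)) :
    (∃ C ε₀ : ℝ, 0 < ε₀ ∧ ∀ (F : Set ℝ) (rd : ℝ → ℝ) (ε : ℝ), 0 ≤ ε → ε ≤ ε₀ →
      Rounding.IsRoundToNearest F rd → (∀ x, |rd x - x| ≤ ε * |x|) →
        MemLp (fun ω => rd (X ω)) k P ∧
        |centralMoment (fun ω => rd (X ω)) k P - centralMoment X k P| ≤ C * ε ^ 2) ∧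
    (Rounding.IsNice f →
      ∃ C δ₀ : ℝ, 0 < δ₀ ∧ ∀ (F : Set ℝ) (rd : ℝ → ℝ) (δ : ℝ), 0 ≤ δ → δ ≤ δ₀ →
        Rounding.IsRoundToNearest F rd → (∀ x, |rd x - x| ≤ δ) →
          MemLp (fun ω => rd (X ω)) k P ∧
          |centralMoment (fun ω => rd (X ω)) k P - centralMoment X k P| ≤ C * δ ^ 2) := by
  have hXk : MemLp X k P := memLp_of_integrable_pow_two_mul hX h_moment
  have htr := fun (g : ℝ → ℝ) (hg : Measurable g) =>
    integrable_comp_and_integral_comp hX hf_meas hf_nonneg hf_density hg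
  have hqint : ∀ n ≤ k, Integrable fun x => x ^ n * f x := fun n hn => by
    have h1 : MemLp X n P := hXk.mono_exponent (by exact_mod_cast hn)
    have h2 : Integrable (fun ω => X ω ^ n) P :=
      h1.integrable_norm_pow'.mono (hX.aestronglyMeasurable.pow n)
        (Filter.Eventually.of_forall fun ω => by simp)
    simpa only [mul_comm] using (htr (fun x => x ^ n) (measurable_id.pow_const n)).1.1 h2
  have hmeas : ∀ (rd : ℝ → ℝ), Measurable rd →
      AEStronglyMeasurable (fun ω => rd (X ω) - X ω) P := fun rd hrd =>
    ((hrd.comp_aemeasurable hX).sub hX).aestronglyMeasurable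
  have hadd : ∀ rd : ℝ → ℝ, (fun ω => X ω + (rd (X ω) - X ω)) = fun ω => rd (X ω) := fun rd => by
    ext ω; ring
  constructor
  -- One power of `x` moves from the error to the density, so the exponents are `1, ..., k` and `f`
  -- itself need not be nice.
  · have hb := fun j : Fin k => exists_abs_integral_mul_le hf_meas hf_nonneg (j + 1)
      (hqint _ j.2) (h_nice _ (Nat.le_add_left 1 _) j.2)
    choose C hC0 hC using hb
    obtain ⟨C', hC'⟩ := exists_centralMoment_add_sub_le P hXk (∑ j, C j * 2)
    refine ⟨C', 1 / 2, by norm_num, fun F rd ε h0 h1 hrd hε => ?_⟩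
    have hN := nearest_of_abs_sub_le hrd fun x =>
      (hε x).trans (by nlinarith [abs_nonneg x])
    have hm : Measurable rd := (monotone_of_nearest hN).measurable
    have h := hC' (fun ω => rd (X ω) - X ω) ε h0 (by linarith) (hmeas rd hm)
      (fun ω => (hε _).trans (by gcongr; linarith)) fun j hj => ?_
    · rwa [hadd] at h
    · have e := (htr (fun x => x ^ j * (rd x - x))
        ((measurable_id.pow_const j).mul (hm.sub measurable_id))).2
      -- This holds at the origin too: the relative bound forces `rd 0 = 0`.
      have e2 : ∀ x, f x * (x ^ j * (rd x - x)) = x ^ (j + 1) * f x * ((rd x - x) / x) :=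
        fun x => by
          rcases eq_or_ne x 0 with rfl | hx
          · have : rd 0 - 0 = 0 := by simpa using hε 0
            simp [this]
          · field_simp
            ring
      simp only [e2] at e
      rw [e]
      have hw : ∀ x, |(rd x - x) / x| ≤ ε := fun x => by
        rw [abs_div]
        exact div_le_of_le_mul₀ (abs_nonneg _) h0 (hε x)
      refine (hC ⟨j, hj⟩ (fun x => (rd x - x) / x) (2 * ε ^ 2) ε
        ((hm.sub measurable_id).div measurable_id) hw fun a b R ha hb => ?_).trans ?_
      · refine (abs_integral_relError_le hN hε ha hb).trans ?_
        gcongr; linarith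
      · rw [← mul_assoc]
        gcongr
        exact Finset.single_le_sum (f := fun j => C j * 2)
          (fun i _ => mul_nonneg (hC0 i) zero_le_two) (Finset.mem_univ (⟨j, hj⟩ : Fin k))
  · intro hf
    have hn : ∀ n < k, IsNice fun x => |x ^ n * f x| := fun n hn => by
      rcases Nat.eq_zero_or_pos n with rfl | hpos
      · simpa only [pow_zero, one_mul, abs_of_nonneg (hf_nonneg _)] using hf
      · exact h_nice n hpos hn.le
    -- The absolute error is used undivided, so the exponents are `0, ..., k - 1`; this is where
    -- niceness of `f` enters.
    have hb := fun j : Fin k => exists_abs_integral_mul_le hf_meas hf_nonneg j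
      (hqint _ j.2.le) (hn _ j.2)
    choose C hC0 hC using hb
    obtain ⟨C', hC'⟩ := exists_centralMoment_add_sub_le P hXk (∑ j, C j)
    refine ⟨C', 1, one_pos, fun F rd δ h0 h1 hrd hδ => ?_⟩
    have hN := nearest_of_abs_sub_le hrd fun x =>
      (hδ x).trans (by linarith [abs_nonneg x])
    have hm : Measurable rd := (monotone_of_nearest hN).measurable
    have h := hC' (fun ω => rd (X ω) - X ω) δ h0 h1 (hmeas rd hm)
      (fun ω => (hδ _).trans (by nlinarith [abs_nonneg (X ω)])) fun j hj => ?_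
    · rwa [hadd] at h
    · have e := (htr (fun x => x ^ j * (rd x - x))
        ((measurable_id.pow_const j).mul (hm.sub measurable_id))).2
      have e2 : ∀ x, f x * (x ^ j * (rd x - x)) = x ^ j * f x * (rd x - x) := fun x => by ring
      simp only [e2] at e
      rw [e]
      refine (hC ⟨j, hj⟩ (fun x => rd x - x) (δ ^ 2) δ (hm.sub measurable_id) hδ
        fun a b R ha _ => ?_).trans ?_
      · have hR : 0 ≤ R := (abs_nonneg a).trans ha
        exact (abs_integral_error_le hN hδ a b).trans (by nlinarith [sq_nonneg δ])
      · gcongr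
        exact Finset.single_le_sum (f := C) (fun i _ => hC0 i)
          (Finset.mem_univ (⟨j, hj⟩ : Fin k))
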